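/- For every $n$ let $P^{(n)}$ be an ergodic (irreducible and aperiodic) transition matrix on a state space $\mathcal X^{(n)}$ of size $n$, with stationary distribution $\pi^{(n)}$, and let $\mathbb P_y,\mathbb E_y$ denote law and expectation of the Markov chain $(X_t)_{t\ge 0}$ with transition matrix $P^{(n)}$ started at $y$. (The conditions on $P^{(n)}$ are needed only for all large $n$; the superscript $(n)$ is dropped.) For $x\in\mathcal X$ let $[P]_x$ be the sub-Markovian kernel obtained from $P$ by removing the row and the column of $x$, and assume that $[P]_x$ is irreducible for every $x$. Let $\lambda_x$ be its leading (Perron) eigenvalue, $\mu^\star_x$ the left eigenvector for $\lambda_x$ that is a probability distribution on $\mathcal X\setminus\{x\}$, and $\gamma_x$ the right eigenvector for $\lambda_x$, normalized by $\langle\mu^\star_x,\gamma_x\rangle=1$. Let $\zeta_t(x)=\sum_{s=0}^{t-1}\mathbf 1_{\{X_s=x\}}$ be the local time at $x$ up to time $t$, and $[a]_+=\max(a,0)$. Assume that there are a real number $c>2$ and a sequence of integers $T=T(n)\to\infty$ such that, as $n\to\infty$, (HP1) $\max_{x,y\in\mathcal X}\left|P^{T}(x,y)-\pi(y)\right|=o(n^{-c})$;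 (HP2) $T\max_{x\in\mathcal X}\pi(x)=o(1)$; (HP3) $\min_{x\in\mathcal X}\pi(x)=\omega(n^{-2})$. Then: (i) $\gamma_x(y)\lesssim 1$ for all $x$ and all $y\neq x$, that is: for every $\varepsilon>0$ and all $n$ large enough, $\gamma_x(y)\le 1+\varepsilon$ for all $x\in\mathcal X$ and $y\in\mathcal X\setminus\{x\}$. (ii) $\gamma_x(y)\gtrsim[1-\mathbb E_y[\zeta_T(x)]]_+$ for all $x$ and all $y\neq x$, in the following sense: for every $\varepsilon>0$ and all $n$ large enough, $\gamma_x(y)\ge\left[1-\mathbb E_y[\zeta_T(x)]-\varepsilon\right]_+$ for all $x\in\mathcal X$ and $y\in\mathcal X\setminus\{x\}$. In particular, for all $\eta,\varepsilon>0$ and all $n$ large enough, $\gamma_x(y)\ge(1-\varepsilon)\left[1-\mathbb E_y[\zeta_T(x)]\right]_+$ for all $x\in\mathcal X$ and $y\in\mathcal X\setminus\{x\}$ such that $\left[1-\mathbb E_y[\zeta_T(x)]\right]_+\ge\eta$. -/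

import Mathlib

open Filter Topology Asymptotics MeasureTheory ProbabilityTheory Matrix

/-- The transition kernel of the Markov chain whose transition matrix is the row-stochastic
matrix `P`: started from `y`, the next state is `z` with probability `P y z`. -/
noncomputable def stepKernel {S : Type*} [Fintype S] [DecidableEq S] [MeasurableSpace S]
    [MeasurableSingletonClass S] (P : rowStochastic ℝ S) : Kernel S S where
  toFun y := ∑ z, ENNReal.ofReal (P.1 y z) • Measure.dirac z
  measurable' := measurable_of_finite _

instance stepKernel_isMarkovKernel {S : Type*} [Fintype S] [DecidableEq S] [MeasurableSpace S]
    [MeasurableSingletonClass S] (P : rowStochastic ℝ S) : IsMarkovKernel (stepKernel P) where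
  isProbabilityMeasure y := ⟨by
    change (∑ z, ENNReal.ofReal (P.1 y z) • Measure.dirac z : Measure S) Set.univ = 1
    simp only [Measure.coe_finsetSum, Measure.coe_smul, Finset.sum_apply, Pi.smul_apply,
      measure_univ, smul_eq_mul, mul_one]
    rw [← ENNReal.ofReal_sum_of_nonneg (fun z _ => P.2.1 y z),
      sum_row_of_mem_rowStochastic P.2 y, ENNReal.ofReal_one]⟩

/-- The law, on the space of trajectories `ℕ → S`, of the Markov chain with transition matrix `P`
started from the state `y`. -/
noncomputable def chainLaw {S : Type*} [Fintype S] [DecidableEq S] [MeasurableSpace S]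
    [MeasurableSingletonClass S] (P : rowStochastic ℝ S) (y : S) : Measure (ℕ → S) :=
  Kernel.traj (X := fun _ => S)
    (fun n => (stepKernel P).comap
      (fun h : (Π _ : Finset.Iic n, S) => h ⟨n, Finset.mem_Iic.2 le_rfl⟩)
      (measurable_pi_apply _))
    0 (fun _ => y)

/-- The local time of the trajectory `ω` at the state `x` within time `t`: the number of
`s ∈ {0, …, t - 1}` with `ω s = x`. -/
def localTime {S : Type*} [DecidableEq S] (t : ℕ) (x : S) (ω : ℕ → S) : ℕ :=
  ∑ s ∈ Finset.range t, if ω s = x then 1 else 0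

/-- The expected local time at `x` within time `t` of the chain started from `y`. -/
noncomputable def expectedLocalTime {S : Type*} [Fintype S] [DecidableEq S] [MeasurableSpace S]
    [MeasurableSingletonClass S] (P : rowStochastic ℝ S) (y : S) (t : ℕ) (x : S) : ℝ :=
  ∫ ω, (localTime t x ω : ℝ) ∂(chainLaw P y)

/-- `p` is a probability vector on the finite set `S`. -/
structure IsProbVector {S : Type*} [Fintype S] (p : S → ℝ) : Prop where
  nonneg : ∀ y, 0 ≤ p y
  sum_eq_one : ∑ y, p y = 1

/-- `π` is a stationary distribution of the transition matrix `P`. -/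
structure IsStationaryDistribution {S : Type*} [Fintype S] (P : Matrix S S ℝ) (π : S → ℝ) :
    Prop extends IsProbVector π where
  stationary : π ᵥ* P = π

/-- The distribution at time `t` of the chain with transition matrix `P` and initial
distribution `α`. -/
noncomputable def evolve {S : Type*} [Fintype S] [DecidableEq S] (P : Matrix S S ℝ)
    (α : S → ℝ) (t : ℕ) : S → ℝ :=
  α ᵥ* P ^ t

/-- The sub-Markovian kernel obtained from `P` by removing the row and the column of `x`. -/
def killedKernel {S : Type*} (P : Matrix S S ℝ) (x : S) :
    Matrix {y : S // y ≠ x} {y : S // y ≠ x} ℝ :=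
  P.submatrix Subtype.val Subtype.val

/-- `lam` is an eigenvalue of `K` with a left eigenvector `μ` that is a probability vector and a
right eigenvector `γ` normalized by `⟨μ, γ⟩ = 1`. For an irreducible nonnegative matrix `K` a
nonnegative eigenvector can only belong to the leading (Perron) eigenvalue, which is simple, so
these conditions determine `lam`, `μ` and `γ`. -/
structure IsPerronTriple {S : Type*} [Fintype S] (K : Matrix S S ℝ) (lam : ℝ) (μ γ : S → ℝ) :
    Prop where
  isProbVector : IsProbVector μ
  left_eigen : μ ᵥ* K = lam • μ
  right_eigen : K *ᵥ γ = lam • γ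
  normalized : μ ⬝ᵥ γ = 1

/-!
The eigenvectors `m`, `g` of the kernel killed at `x` are extended by zero to the whole space, with
`g` of maximum `M`. Everything follows from comparing `P ^ T` with its stationary limit on them.

*The eigenvalue.* The survival probability from stationarity, `a t = P_π (τ_x > t)`, satisfies
`a (t + 1) ≥ (1 - 4 π(x)) a t` (`survival_decay`). Indeed the chance of a first visit to `x` at time
`t + 1` is at most `π(x)` by stationarity, and for `t ≥ T` at most `2 π(x) a (t - T)` by mixing, where
`a (t - T) ≤ 2 a t` by the same inequality at the earlier times. Starting from `m` instead of `π`,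
the survival probability is exactly `lam ^ t`, so `lam ≥ 1 - 4 π(x)` and `lam ^ T ≥ 1 - 4 T π(x)`
(`IsExtendedPerronTriple.eigenvalue_ge`).

*The upper bound.* From `lam ^ T m ≤ m P ^ T`, and `m P ^ T ≈ π`, the excess of `m` over `π`, and
hence that of `π` over `m`, has small total mass; as `⟨m, g⟩ = 1` this gives `⟨π, g⟩ ≤ 1 + o(1) M`.
On the other hand `lam ^ T M ≤ max (P ^ T g) ≤ ⟨π, g⟩ + o(1) M`. So `M ≤ 1 + o(1)`.

*The lower bound.* `P g` differs from `lam g` only at `x`, by at most `M`. Iterating,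
`P ^ T g ≤ lam ^ T g + M G` with `G y = ∑ s < T, P ^ s (y, x)`, which is the expected local time
(`expectedLocalTime_eq_sum`). As `P ^ T g ≥ ⟨π, g⟩ - o(1) M ≥ (1 - o(1)) M` and `M ≥ 1`, this yields
`g ≥ 1 - G - o(1)` wherever the right-hand side is positive; elsewhere `g ≥ 0` suffices.
-/

/-! ### Perron eigenvectors of irreducible matrices -/

theorem pow_mulVec_of_right_eigen {S : Type*} [Fintype S] [DecidableEq S] {K : Matrix S S ℝ}
    {lam : ℝ} {v : S → ℝ} (h : K *ᵥ v = lam • v) (k : ℕ) : K ^ k *ᵥ v = lam ^ k • v := by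
  induction k with
  | zero => simp
  | succ k ih => rw [pow_succ', ← mulVec_mulVec, ih, mulVec_smul, h, smul_smul, pow_succ]

/-- A nonzero nonnegative eigenvector of an irreducible matrix is positive everywhere. -/
theorem Matrix.IsIrreducible.pos_of_right_eigen {S : Type*} [Fintype S] [DecidableEq S]
    {K : Matrix S S ℝ} (hK : K.IsIrreducible) {lam : ℝ} {v : S → ℝ} (hv : ∀ i, 0 ≤ v i)
    (hlam : 0 ≤ lam) (h : K *ᵥ v = lam • v) {i : S} (hi : 0 < v i) (j : S) : 0 < v j := by
  obtain ⟨k, -, hk⟩ := (isIrreducible_iff_exists_pow_pos hK.nonneg).1 hK j i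
  have h1 : (K ^ k) j i * v i ≤ (K ^ k *ᵥ v) j :=
    Finset.single_le_sum (f := fun l => (K ^ k) j l * v l)
      (fun l _ => mul_nonneg (pow_apply_nonneg hK.nonneg k j l) (hv l)) (Finset.mem_univ i)
  rw [pow_mulVec_of_right_eigen h k, Pi.smul_apply, smul_eq_mul] at h1
  exact pos_of_mul_pos_right ((mul_pos hk hi).trans_le h1) (pow_nonneg hlam k)

theorem IsProbVector.exists_pos {S : Type*} [Fintype S] {p : S → ℝ} (hp : IsProbVector p) :
    ∃ i, 0 < p i := by
  obtain ⟨i, -, hi⟩ := Finset.exists_ne_zero_of_sum_ne_zero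
    (s := Finset.univ) (f := p) (by rw [hp.sum_eq_one]; exact one_ne_zero)
  exact ⟨i, (hp.nonneg i).lt_of_ne' hi⟩

namespace IsPerronTriple

variable {S : Type*} [Fintype S] {K : Matrix S S ℝ} {lam : ℝ} {μ γ : S → ℝ}

theorem eigenvalue_eq (h : IsPerronTriple K lam μ γ) : lam = μ ⬝ᵥ (K *ᵥ 1) := by
  rw [dotProduct_mulVec, h.left_eigen, smul_dotProduct, dotProduct_one, h.isProbVector.sum_eq_one,
    smul_eq_mul, mul_one]

theorem eigenvalue_nonneg (h : IsPerronTriple K lam μ γ) (hK : ∀ i j, 0 ≤ K i j) : 0 ≤ lam := by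
  rw [h.eigenvalue_eq]
  exact dotProduct_nonneg_of_nonneg h.isProbVector.nonneg fun i =>
    dotProduct_nonneg_of_nonneg (hK i) fun _ => zero_le_one

theorem eigenvalue_le_one (h : IsPerronTriple K lam μ γ) (hK : ∀ i, ∑ j, K i j ≤ 1) :
    lam ≤ 1 := by
  rw [h.eigenvalue_eq, ← h.isProbVector.sum_eq_one]
  refine Finset.sum_le_sum fun i _ => mul_le_of_le_one_right (h.isProbVector.nonneg i) ?_
  simpa [mulVec, dotProduct] using hK i

theorem left_pos [DecidableEq S] (h : IsPerronTriple K lam μ γ) (hK : K.IsIrreducible) (i : S) :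
    0 < μ i := by
  obtain ⟨j, hj⟩ := h.isProbVector.exists_pos
  refine hK.transpose.pos_of_right_eigen h.isProbVector.nonneg (h.eigenvalue_nonneg hK.nonneg) ?_
    hj i
  rw [mulVec_transpose, h.left_eigen]

/-- Pairing `K *ᵥ |γ| ≥ lam • |γ|` with the positive left eigenvector shows that `|γ|`, hence
`|γ| - γ`, is an eigenvector too. The latter is nonnegative, so it vanishes identically or is
positive everywhere; in the second case `γ < 0`, which contradicts `μ ⬝ᵥ γ = 1`. -/
theorem right_nonneg [DecidableEq S] (h : IsPerronTriple K lam μ γ) (hK : K.IsIrreducible) (i : S) :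
    0 ≤ γ i := by
  have hlam := h.eigenvalue_nonneg hK.nonneg
  set w : S → ℝ := fun j => |γ j| with hw
  have hle : ∀ j, 0 ≤ (K *ᵥ w - lam • w) j := by
    intro j
    have h1 : (K *ᵥ γ) j = lam * γ j := by rw [h.right_eigen]; rfl
    have h2 : lam * |γ j| ≤ (K *ᵥ w) j := by
      rw [← abs_of_nonneg hlam, ← abs_mul, ← h1]
      refine (Finset.abs_sum_le_sum_abs _ _).trans (Finset.sum_le_sum fun l _ => ?_)
      rw [abs_mul, abs_of_nonneg (hK.nonneg j l)]
    simpa [hw] using h2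
  have hzero : μ ⬝ᵥ (K *ᵥ w - lam • w) = 0 := by
    rw [dotProduct_sub, dotProduct_mulVec, h.left_eigen, smul_dotProduct, dotProduct_smul, sub_self]
  have heig : K *ᵥ w = lam • w := by
    ext j
    have := (Finset.sum_eq_zero_iff_of_nonneg fun l _ =>
      mul_nonneg (h.isProbVector.nonneg l) (hle l)).1 hzero j (Finset.mem_univ j)
    have := (mul_eq_zero.1 this).resolve_left (h.left_pos hK j).ne'
    exact sub_eq_zero.1 this
  have heig' : K *ᵥ (w - γ) = lam • (w - γ) := by
    rw [mulVec_sub, heig, h.right_eigen, smul_sub]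
  by_contra! hi
  have hpos : ∀ j, 0 < (w - γ) j := hK.pos_of_right_eigen
    (fun j => sub_nonneg.2 (le_abs_self _)) hlam heig' (i := i)
    (sub_pos.2 (hi.trans_le (abs_nonneg _)))
  have hneg : ∀ j, γ j ≤ 0 := by
    intro j
    by_contra! hj
    have := hpos j
    simp [hw, abs_of_pos hj] at this
  have : μ ⬝ᵥ γ ≤ 0 := Finset.sum_nonpos fun j _ =>
    mul_nonpos_of_nonneg_of_nonpos (h.isProbVector.nonneg j) (hneg j)
  linarith [h.normalized]

end IsPerronTriple

/-! ### Extension of the Perron eigenvectors by zero -/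

/-- The left and right Perron eigenvectors `m`, `g` of the kernel killed at `x`, extended by zero
to the whole state space: the eigenvalue equations hold off `x`. -/
structure IsExtendedPerronTriple {S : Type*} [Fintype S] (P : Matrix S S ℝ) (x : S) (lam : ℝ)
    (m g : S → ℝ) : Prop where
  eigenvalue_nonneg : 0 ≤ lam
  eigenvalue_le_one : lam ≤ 1
  left_zero : m x = 0
  left_pos : ∀ y, y ≠ x → 0 < m y
  left_sum : ∑ y, m y = 1
  left_eigen : ∀ y, y ≠ x → (m ᵥ* P) y = lam * m y
  right_zero : g x = 0
  right_nonneg : ∀ y, 0 ≤ g y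
  right_eigen : ∀ y, y ≠ x → (P *ᵥ g) y = lam * g y
  normalized : m ⬝ᵥ g = 1

theorem sum_eq_sum_subtype_ne {S : Type*} [Fintype S] [DecidableEq S] (x : S) {f : S → ℝ}
    (hf : f x = 0) : ∑ y, f y = ∑ y : {y : S // y ≠ x}, f y := by
  rw [← Fintype.sum_subtype_add_sum_subtype (· ≠ x) f, add_eq_left]
  exact Finset.sum_eq_zero fun y _ => by rw [not_not.1 y.2, hf]

/-- Extension by zero at `x` of a function on the complement of `x`. -/
def extendZero {S : Type*} [DecidableEq S] (x : S) (f : {y : S // y ≠ x} → ℝ) (y : S) : ℝ :=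
  if h : y ≠ x then f ⟨y, h⟩ else 0

section extendZero

variable {S : Type*} [DecidableEq S] {x : S} (f : {y : S // y ≠ x} → ℝ)

@[simp] theorem extendZero_self : extendZero x f x = 0 := by simp [extendZero]

@[simp] theorem extendZero_coe (y : {y : S // y ≠ x}) : extendZero x f y = f y := by
  simp [extendZero, y.2]

end extendZero

theorem IsPerronTriple.extendZero {S : Type*} [Fintype S] [DecidableEq S] {P : Matrix S S ℝ}
    (hP : P ∈ rowStochastic ℝ S) {x : S} {lam : ℝ} {μ γ : {y : S // y ≠ x} → ℝ}
    (h : IsPerronTriple (killedKernel P x) lam μ γ) (hK : (killedKernel P x).IsIrreducible) :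
    IsExtendedPerronTriple P x lam (_root_.extendZero x μ) (_root_.extendZero x γ) where
  eigenvalue_nonneg := h.eigenvalue_nonneg hK.nonneg
  eigenvalue_le_one := by
    refine h.eigenvalue_le_one fun i => ?_
    rw [← sum_row_of_mem_rowStochastic hP i, ← Fintype.sum_subtype_add_sum_subtype (· ≠ x)]
    exact le_add_of_nonneg_right (Finset.sum_nonneg fun j _ => hP.1 _ _)
  left_zero := extendZero_self _
  left_pos y hy := by
    simpa using (extendZero_coe μ ⟨y, hy⟩).symm ▸ h.left_pos hK ⟨y, hy⟩
  left_sum := by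
    rw [sum_eq_sum_subtype_ne x (extendZero_self _), ← h.isProbVector.sum_eq_one]
    simp
  left_eigen y hy := by
    have := congrFun h.left_eigen ⟨y, hy⟩
    rw [Pi.smul_apply, smul_eq_mul, ← extendZero_coe μ ⟨y, hy⟩] at this
    rw [← this]
    refine (sum_eq_sum_subtype_ne x (by simp)).trans ?_
    simp [vecMul, dotProduct, killedKernel]
  right_zero := extendZero_self _
  right_nonneg y := by
    by_cases hy : y = x
    · simp [hy]
    · simpa using (extendZero_coe γ ⟨y, hy⟩).symm ▸ h.right_nonneg hK ⟨y, hy⟩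
  right_eigen y hy := by
    have := congrFun h.right_eigen ⟨y, hy⟩
    rw [Pi.smul_apply, smul_eq_mul, ← extendZero_coe γ ⟨y, hy⟩] at this
    rw [← this]
    refine (sum_eq_sum_subtype_ne x (by simp)).trans ?_
    simp [mulVec, dotProduct, killedKernel]
  normalized := by
    rw [← h.normalized]
    refine (sum_eq_sum_subtype_ne x (by simp)).trans ?_
    simp [dotProduct]

/-! ### Expected local times -/

section LocalTime

variable {S : Type*} [Fintype S] [DecidableEq S] [MeasurableSpace S] [MeasurableSingletonClass S]

instance chainLaw_isProbabilityMeasure (P : rowStochastic ℝ S) (y : S) :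
    IsProbabilityMeasure (chainLaw P y) := by
  unfold chainLaw; infer_instance

theorem stepKernel_singleton (P : rowStochastic ℝ S) (y z : S) :
    stepKernel P y {z} = ENNReal.ofReal (P.1 y z) := by
  change (∑ w, ENNReal.ofReal (P.1 y w) • Measure.dirac w : Measure S) {z} = _
  simp [Measure.dirac_apply' _ (measurableSet_singleton z), Set.indicator_apply]

theorem chainLaw_map_zero (P : rowStochastic ℝ S) (y : S) :
    (chainLaw P y).map (fun ω => ω 0) = Measure.dirac y := by
  have h := Kernel.traj_map_frestrictLe_apply (X := fun _ => S)
    (κ := fun n => (stepKernel P).comap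
      (fun h : (Π _ : Finset.Iic n, S) => h ⟨n, Finset.mem_Iic.2 le_rfl⟩)
      (measurable_pi_apply _)) 0 0 (fun _ => y)
  have hf : (fun ω : ℕ → S => ω 0) =
      (fun h : (Π _ : Finset.Iic 0, S) => h ⟨0, Finset.mem_Iic.2 le_rfl⟩) ∘
        Preorder.frestrictLe (π := fun _ => S) 0 := rfl
  rw [chainLaw, hf, ← Measure.map_map (by fun_prop) (by fun_prop), h, Kernel.partialTraj_self,
    Kernel.id_apply]
  exact Measure.map_dirac' (f := fun h : (Π _ : Finset.Iic 0, S) => h ⟨0, Finset.mem_Iic.2 le_rfl⟩)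
    (by fun_prop) _

/-- The one-dimensional marginals of the chain evolve by the transition kernel. -/
theorem chainLaw_map_succ (P : rowStochastic ℝ S) (y : S) (t : ℕ) :
    (chainLaw P y).map (fun ω => ω (t + 1)) =
      ((chainLaw P y).map (fun ω => ω t)).bind (stepKernel P) := by
  set κ : (n : ℕ) → Kernel (Π _ : Finset.Iic n, S) S := fun n => (stepKernel P).comap
      (fun h : (Π _ : Finset.Iic n, S) => h ⟨n, Finset.mem_Iic.2 le_rfl⟩)
      (measurable_pi_apply _) with hκ
  have h1 := Kernel.traj_map_frestrictLe_apply (X := fun _ => S) (κ := κ) 0 (t + 1) (fun _ => y)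
  have h2 := Kernel.traj_map_frestrictLe_apply (X := fun _ => S) (κ := κ) 0 t (fun _ => y)
  have hf (s : ℕ) : (fun ω : ℕ → S => ω s) =
      (fun h : (Π _ : Finset.Iic s, S) => h ⟨s, Finset.mem_Iic.2 le_rfl⟩) ∘
        Preorder.frestrictLe (π := fun _ => S) s := rfl
  have h3 := Kernel.map_partialTraj_succ_self (X := fun _ => S) (κ := κ) t
  change (Kernel.traj (X := fun _ => S) κ 0 (fun _ => y)).map (fun ω => ω (t + 1)) =
    ((Kernel.traj (X := fun _ => S) κ 0 (fun _ => y)).map (fun ω => ω t)).bind (stepKernel P)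
  rw [hf, hf t, ← Measure.map_map (by fun_prop) (by fun_prop),
    ← Measure.map_map (by fun_prop) (by fun_prop), h1, h2,
    Kernel.partialTraj_succ_eq_comp t.zero_le, Kernel.comp_apply, Measure.map_comp _ _ (by fun_prop),
    h3]
  ext s hs
  rw [Measure.bind_apply hs (by fun_prop), Measure.bind_apply hs (by fun_prop),
    lintegral_map (by fun_prop) (by fun_prop)]
  rfl

theorem chainLaw_real_eq (P : rowStochastic ℝ S) (y x : S) (t : ℕ) :
    (chainLaw P y).real {ω | ω t = x} = (P.1 ^ t) y x := by
  have key : ∀ x, (chainLaw P y).map (fun ω => ω t) {x} = ENNReal.ofReal ((P.1 ^ t) y x) := by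
    induction t with
    | zero =>
      intro x
      rw [chainLaw_map_zero, Measure.dirac_apply' _ (measurableSet_singleton x), pow_zero, one_apply]
      by_cases h : y = x <;> simp [h]
    | succ t ih =>
      intro x
      rw [chainLaw_map_succ, Measure.bind_apply (measurableSet_singleton x) (by fun_prop),
        lintegral_fintype, pow_succ, mul_apply, ENNReal.ofReal_sum_of_nonneg
          fun z _ => mul_nonneg (pow_apply_nonneg P.2.1 t y z) (P.2.1 z x)]
      refine Finset.sum_congr rfl fun z _ => ?_
      rw [ih z, stepKernel_singleton, ENNReal.ofReal_mul (pow_apply_nonneg P.2.1 t y z), mul_comm]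
  have := key x
  rw [Measure.map_apply (by fun_prop) (measurableSet_singleton x)] at this
  change ((chainLaw P y) {ω | ω t = x}).toReal = _
  rw [← ENNReal.toReal_ofReal (pow_apply_nonneg P.2.1 t y x), ← this]
  rfl

theorem expectedLocalTime_eq_sum (P : rowStochastic ℝ S) (y x : S) (t : ℕ) :
    expectedLocalTime P y t x = ∑ s ∈ Finset.range t, (P.1 ^ s) y x := by
  have hm (s : ℕ) : MeasurableSet {ω : ℕ → S | ω s = x} :=
    measurableSet_eq_fun (measurable_pi_apply s) measurable_const
  have hf (ω : ℕ → S) : (localTime t x ω : ℝ) =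
      ∑ s ∈ Finset.range t, Set.indicator {ω : ℕ → S | ω s = x} (fun _ => (1 : ℝ)) ω := by
    simp [localTime, Set.indicator_apply]
  simp_rw [expectedLocalTime, hf]
  rw [integral_finsetSum _ fun s _ => (integrable_const 1).indicator (hm s)]
  refine Finset.sum_congr rfl fun s _ => ?_
  rw [integral_indicator_const _ (hm s), chainLaw_real_eq, smul_eq_mul, mul_one]

end LocalTime

/-! ### Survival probabilities -/

section Survival

variable {S : Type*} [Fintype S] [DecidableEq S]

/-- The probability, as a function of the starting point, that the chain with transition matrix
`P` avoids `x` at the times `0, …, t`. -/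
noncomputable def survival (P : Matrix S S ℝ) (x : S) : ℕ → S → ℝ
  | 0 => fun y => if y = x then 0 else 1
  | t + 1 => fun y => if y = x then 0 else (P *ᵥ survival P x t) y

theorem mulVec_mono_of_mem_rowStochastic {P : Matrix S S ℝ} (hP : P ∈ rowStochastic ℝ S)
    {u v : S → ℝ} (h : u ≤ v) : P *ᵥ u ≤ P *ᵥ v := fun y =>
  Finset.sum_le_sum fun z _ => mul_le_mul_of_nonneg_left (h z) (hP.1 y z)

theorem mulVec_le_const_of_mem_rowStochastic {P : Matrix S S ℝ} (hP : P ∈ rowStochastic ℝ S)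
    {v : S → ℝ} {b : ℝ} (h : ∀ y, v y ≤ b) (y : S) : (P *ᵥ v) y ≤ b := by
  calc (P *ᵥ v) y ≤ ∑ z, P y z * b :=
        Finset.sum_le_sum fun z _ => mul_le_mul_of_nonneg_left (h z) (hP.1 y z)
    _ = b := by rw [← Finset.sum_mul, sum_row_of_mem_rowStochastic hP, one_mul]

variable {P : Matrix S S ℝ} {x : S}

@[simp] theorem survival_self (t : ℕ) : survival P x t x = 0 := by cases t <;> simp [survival]

theorem survival_nonneg (hP : P ∈ rowStochastic ℝ S) (t : ℕ) (y : S) : 0 ≤ survival P x t y := by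
  induction t generalizing y with
  | zero => simp only [survival]; split_ifs <;> norm_num
  | succ t ih =>
    simp only [survival]
    split_ifs
    · exact le_rfl
    · exact dotProduct_nonneg_of_nonneg (hP.1 y) ih

theorem survival_succ_le (hP : P ∈ rowStochastic ℝ S) (t : ℕ) :
    survival P x (t + 1) ≤ P *ᵥ survival P x t := fun y => by
  simp only [survival]
  split_ifs
  · exact dotProduct_nonneg_of_nonneg (hP.1 y) (survival_nonneg hP t)
  · exact le_rfl

theorem survival_le_one (hP : P ∈ rowStochastic ℝ S) (t : ℕ) (y : S) : survival P x t y ≤ 1 := by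
  induction t generalizing y with
  | zero => simp only [survival]; split_ifs <;> norm_num
  | succ t ih =>
    exact (survival_succ_le hP t y).trans (mulVec_le_const_of_mem_rowStochastic hP ih y)

theorem survival_add_le (hP : P ∈ rowStochastic ℝ S) (s t : ℕ) :
    survival P x (t + s) ≤ P ^ s *ᵥ survival P x t := by
  induction s with
  | zero => simp
  | succ s ih =>
    refine (survival_succ_le hP (t + s)).trans ?_
    rw [pow_succ', ← mulVec_mulVec]
    exact mulVec_mono_of_mem_rowStochastic hP ih

/-- From stationarity the survival probability drops, between the times `t` and `t + 1`, by the
probability of starting at `x` and then avoiding `x` at the times `1, …, t + 1`: this is the law of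
the first visit, read backwards in time. -/
theorem dotProduct_survival_succ {π : S → ℝ} (hπ : IsStationaryDistribution P π) (t : ℕ) :
    π ⬝ᵥ survival P x (t + 1) = π ⬝ᵥ survival P x t - π x * (P *ᵥ survival P x t) x := by
  have h : survival P x (t + 1) = P *ᵥ survival P x t - Pi.single x ((P *ᵥ survival P x t) x) := by
    ext y
    by_cases hy : y = x
    · subst hy; simp
    · simp [survival, hy]
  rw [h, dotProduct_sub, dotProduct_mulVec, hπ.stationary, dotProduct_single]

/-- From time `T` on, survival up to time `t` is at most survival up to `t - T` from stationarity,
up to a factor `2`; hence the hazard at time `t` is at most `2 * π x` times the ratio of the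
survival probabilities at `t - T` and `t`, a ratio which the induction hypothesis itself bounds
by `2`. -/
theorem survival_decay (hP : P ∈ rowStochastic ℝ S) {π : S → ℝ}
    (hπ : IsStationaryDistribution P π) {T : ℕ} (hT : 1 ≤ T)
    (hmix : ∀ y z, (P ^ T) y z ≤ 2 * π z) (hTx : T * π x ≤ 1 / 8) (t : ℕ) :
    (1 - 4 * π x) * (π ⬝ᵥ survival P x t) ≤ π ⬝ᵥ survival P x (t + 1) := by
  set a : ℕ → ℝ := fun t => π ⬝ᵥ survival P x t with ha
  have hx0 : 0 ≤ π x := hπ.nonneg x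
  have hT' : (1 : ℝ) ≤ T := by exact_mod_cast hT
  have hx : π x ≤ 1 / 8 := (le_mul_of_one_le_left hx0 hT').trans hTx
  have hstep (s : ℕ) : a (s + 1) = a s - π x * (P *ᵥ survival P x s) x :=
    dotProduct_survival_succ hπ s
  have hstep_le (s : ℕ) : a s - π x ≤ a (s + 1) := by
    rw [hstep]
    have := mulVec_le_const_of_mem_rowStochastic hP (survival_le_one (x := x) hP s) x
    linarith [mul_le_of_le_one_right hx0 this]
  have hearly (s : ℕ) : 1 - (s + 1) * π x ≤ a s := by
    induction s with
    | zero =>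
      have : π ⬝ᵥ survival P x 0 = 1 - π x := by
        have h : survival P x 0 = 1 - Pi.single x 1 := by
          ext y
          by_cases hy : y = x
          · subst hy; simp
          · simp [survival, hy]
        rw [h, dotProduct_sub, dotProduct_single, dotProduct_one, hπ.sum_eq_one, mul_one]
      simp [ha, this]
    | succ s ih => push_cast; linarith [hstep_le s]
  have ha0 (s : ℕ) : 0 ≤ a s := dotProduct_nonneg_of_nonneg hπ.nonneg (survival_nonneg hP s)
  induction t using Nat.strong_induction_on with
  | _ t ih =>
    change (1 - 4 * π x) * a t ≤ a (t + 1)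
    rcases lt_or_ge t T with htT | htT
    · -- before time `T` a visit to `x` is unlikely, so `a t ≥ 1 / 2`
      have h1 : ((t : ℝ) + 1) * π x ≤ T * π x :=
        mul_le_mul_of_nonneg_right (by exact_mod_cast htT) hx0
      have h2 : 1 / 2 ≤ a t := by linarith [hearly t]
      nlinarith [hstep_le t, mul_le_mul_of_nonneg_left h2 hx0]
    · obtain ⟨s, rfl⟩ := Nat.exists_eq_add_of_le' htT
      have hback (k : ℕ) (hk : k ≤ T) : (1 - 4 * π x) ^ k * a s ≤ a (s + k) := by
        induction k with
        | zero => simp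
        | succ k ihk =>
          refine le_trans ?_ (ih (s + k) (by omega))
          rw [pow_succ', mul_assoc]
          exact mul_le_mul_of_nonneg_left (ihk (by omega)) (by linarith)
      -- Bernoulli's inequality
      have hbern : 1 / 2 ≤ (1 - 4 * π x) ^ T := by
        have := one_add_mul_le_pow (a := -(4 * π x)) (by linarith) T
        rw [← sub_eq_add_neg] at this
        linarith
      have hratio : a s ≤ 2 * a (s + T) := by
        linarith [mul_le_mul_of_nonneg_right hbern (ha0 s), hback T le_rfl]
      have hhit : (P *ᵥ survival P x (s + T)) x ≤ 2 * a s := by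
        refine mulVec_le_const_of_mem_rowStochastic hP (fun y => ?_) x
        refine (survival_add_le hP T s y).trans ?_
        simp only [ha, dotProduct, Finset.mul_sum]
        refine Finset.sum_le_sum fun z _ => ?_
        rw [← mul_assoc]
        exact mul_le_mul_of_nonneg_right (hmix y z) (survival_nonneg hP s z)
      rw [hstep]
      nlinarith [mul_le_mul_of_nonneg_left (hhit.trans (mul_le_mul_of_nonneg_left hratio
        zero_le_two)) hx0]

end Survival

/-! ### Bounds on the eigenvalue and the eigenvectors for a fixed state space -/

namespace IsExtendedPerronTriple

variable {S : Type*} [Fintype S] [DecidableEq S] {P : Matrix S S ℝ} {x : S} {lam : ℝ}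
  {m g : S → ℝ}

theorem left_nonneg (h : IsExtendedPerronTriple P x lam m g) (y : S) : 0 ≤ m y := by
  by_cases hy : y = x
  · rw [hy, h.left_zero]
  · exact (h.left_pos y hy).le

theorem dotProduct_survival (h : IsExtendedPerronTriple P x lam m g) (t : ℕ) :
    m ⬝ᵥ survival P x t = lam ^ t := by
  induction t with
  | zero =>
    rw [pow_zero, ← h.left_sum]
    refine Finset.sum_congr rfl fun y _ => ?_
    by_cases hy : y = x
    · simp [hy, h.left_zero]
    · simp [survival, hy]
  | succ t ih =>
    calc m ⬝ᵥ survival P x (t + 1) = m ⬝ᵥ (P *ᵥ survival P x t) := by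
          refine Finset.sum_congr rfl fun y _ => ?_
          by_cases hy : y = x
          · simp [hy, h.left_zero]
          · simp [survival, hy]
      _ = ∑ y, lam * (m y * survival P x t y) := by
          rw [dotProduct_mulVec]
          refine Finset.sum_congr rfl fun y _ => ?_
          by_cases hy : y = x
          · simp [hy]
          · rw [h.left_eigen y hy, mul_assoc]
      _ = lam ^ (t + 1) := by rw [← Finset.mul_sum, pow_succ', ← ih]; rfl

/-- The survival probability from `m` decays exactly like `lam ^ t`, and `m` dominates a multiple
of `π` off `x`. -/
theorem eigenvalue_ge (h : IsExtendedPerronTriple P x lam m g) (hP : P ∈ rowStochastic ℝ S)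
    {π : S → ℝ} (hπ : IsStationaryDistribution P π) {T : ℕ} (hT : 1 ≤ T)
    (hmix : ∀ y z, (P ^ T) y z ≤ 2 * π z) (hTx : T * π x ≤ 1 / 8) : 1 - 4 * π x ≤ lam := by
  have hx0 : 0 ≤ π x := hπ.nonneg x
  have hx : π x ≤ 1 / 8 := (le_mul_of_one_le_left hx0 (by exact_mod_cast hT)).trans hTx
  have hr : 0 < 1 - 4 * π x := by linarith
  have hpos : 0 < π ⬝ᵥ survival P x 0 := by
    have hsum := hπ.sum_eq_one
    have : π ⬝ᵥ survival P x 0 = ∑ y, π y - π x := by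
      rw [← Finset.add_sum_erase _ _ (Finset.mem_univ x), add_sub_cancel_left,
        dotProduct, ← Finset.add_sum_erase _ _ (Finset.mem_univ x), survival_self, mul_zero, zero_add]
      refine Finset.sum_congr rfl fun y hy => ?_
      simp [survival, Finset.ne_of_mem_erase hy]
    linarith
  have hlower (t : ℕ) : (1 - 4 * π x) ^ t * (π ⬝ᵥ survival P x 0) ≤ π ⬝ᵥ survival P x t := by
    induction t with
    | zero => simp
    | succ t ih =>
      rw [pow_succ', mul_assoc]
      exact (mul_le_mul_of_nonneg_left ih hr.le).trans (survival_decay hP hπ hT hmix hTx t)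
  set C := ∑ y, π y / m y with hC
  have hdom (y : S) (hy : y ≠ x) : π y ≤ C * m y := by
    rw [← div_le_iff₀ (h.left_pos y hy)]
    exact Finset.single_le_sum (f := fun y => π y / m y)
      (fun z _ => div_nonneg (hπ.nonneg z) (h.left_nonneg z)) (Finset.mem_univ y)
  have hupper (t : ℕ) : π ⬝ᵥ survival P x t ≤ C * lam ^ t := by
    rw [← h.dotProduct_survival, dotProduct, dotProduct, Finset.mul_sum]
    refine Finset.sum_le_sum fun y _ => ?_
    by_cases hy : y = x
    · simp [hy]
    · rw [← mul_assoc]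
      exact mul_le_mul_of_nonneg_right (hdom y hy) (survival_nonneg hP t y)
  by_contra! hlt
  have hlim : Tendsto (fun t : ℕ => C * (lam / (1 - 4 * π x)) ^ t) atTop (𝓝 (C * 0)) :=
    (tendsto_pow_atTop_nhds_zero_of_lt_one (div_nonneg h.eigenvalue_nonneg hr.le)
      ((div_lt_one hr).2 hlt)).const_mul C
  rw [mul_zero] at hlim
  refine hpos.not_ge (ge_of_tendsto' hlim fun t => ?_)
  rw [div_pow, ← mul_div_assoc, le_div_iff₀ (pow_pos hr t), mul_comm]
  exact (hlower t).trans (hupper t)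

theorem eigenvalue_pow_ge (h : IsExtendedPerronTriple P x lam m g) (hP : P ∈ rowStochastic ℝ S)
    {π : S → ℝ} (hπ : IsStationaryDistribution P π) {T : ℕ} (hT : 1 ≤ T)
    (hmix : ∀ y z, (P ^ T) y z ≤ 2 * π z) (hTx : T * π x ≤ 1 / 8) :
    1 - 4 * (T * π x) ≤ lam ^ T := by
  have h1 := h.eigenvalue_ge hP hπ hT hmix hTx
  have := one_add_mul_le_pow (a := lam - 1) (by linarith [h.eigenvalue_nonneg]) T
  rw [add_sub_cancel] at this
  nlinarith [(Nat.cast_nonneg T : (0 : ℝ) ≤ T)]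

/-- Off `x` the vector `g` is an eigenvector of `P`, so `P *ᵥ g` exceeds `lam • g` only at `x`, by
the amount `(P *ᵥ g) x ≤ M`; each later visit to `x` contributes at most that much. -/
theorem pow_mulVec_right_le (h : IsExtendedPerronTriple P x lam m g)
    (hP : P ∈ rowStochastic ℝ S) {M : ℝ} (hM : ∀ y, g y ≤ M) (hM0 : 0 ≤ M) (t : ℕ) (y : S) :
    (P ^ t *ᵥ g) y ≤ lam ^ t * g y + M * ∑ s ∈ Finset.range t, (P ^ s) y x := by
  have hone : P *ᵥ g ≤ lam • g + M • Pi.single x 1 := fun y => by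
    by_cases hy : y = x
    · subst hy
      simpa [h.right_zero] using mulVec_le_const_of_mem_rowStochastic hP hM y
    · simp [hy, h.right_eigen y hy]
  induction t with
  | zero => simp
  | succ t ih =>
    have hPt : P ^ t ∈ rowStochastic ℝ S := pow_mem hP t
    have hstep : (P ^ (t + 1) *ᵥ g) y ≤ lam * (P ^ t *ᵥ g) y + M * (P ^ t) y x := by
      have := mulVec_mono_of_mem_rowStochastic hPt hone y
      rw [mulVec_mulVec, ← pow_succ] at this
      simpa [mulVec_add, mulVec_smul] using this
    have hG : 0 ≤ M * ∑ s ∈ Finset.range t, (P ^ s) y x :=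
      mul_nonneg hM0 (Finset.sum_nonneg fun s _ => pow_apply_nonneg hP.1 s y x)
    rw [Finset.sum_range_succ, mul_add, pow_succ' lam, mul_assoc]
    nlinarith [mul_le_mul_of_nonneg_left ih h.eigenvalue_nonneg,
      mul_le_of_le_one_left hG h.eigenvalue_le_one]

theorem pow_mul_right_le (h : IsExtendedPerronTriple P x lam m g)
    (hP : P ∈ rowStochastic ℝ S) (t : ℕ) (y : S) : lam ^ t * g y ≤ (P ^ t *ᵥ g) y := by
  have hone : lam • g ≤ P *ᵥ g := fun y => by
    by_cases hy : y = x
    · subst hy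
      rw [Pi.smul_apply, h.right_zero, smul_zero]
      exact dotProduct_nonneg_of_nonneg (hP.1 y) h.right_nonneg
    · simp [h.right_eigen y hy]
  induction t with
  | zero => simp
  | succ t ih =>
    have := mulVec_mono_of_mem_rowStochastic (pow_mem hP t) hone y
    rw [mulVec_mulVec, ← pow_succ, mulVec_smul, Pi.smul_apply, smul_eq_mul] at this
    rw [pow_succ', mul_assoc]
    exact (mul_le_mul_of_nonneg_left ih h.eigenvalue_nonneg).trans this

theorem pow_mul_left_le (h : IsExtendedPerronTriple P x lam m g)
    (hP : P ∈ rowStochastic ℝ S) (t : ℕ) (z : S) : lam ^ t * m z ≤ (m ᵥ* P ^ t) z := by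
  induction t generalizing z with
  | zero => simp
  | succ t ih =>
    calc lam ^ (t + 1) * m z ≤ lam ^ t * (m ᵥ* P) z := by
          rw [pow_succ, mul_assoc]
          refine mul_le_mul_of_nonneg_left ?_ (pow_nonneg h.eigenvalue_nonneg t)
          by_cases hz : z = x
          · rw [hz, h.left_zero, mul_zero]
            exact dotProduct_nonneg_of_nonneg h.left_nonneg fun y => hP.1 y x
          · exact (h.left_eigen z hz).ge
      _ = ∑ y, (lam ^ t * m y) * P y z := by
          rw [vecMul, dotProduct, Finset.mul_sum]
          exact Finset.sum_congr rfl fun y _ => (mul_assoc _ _ _).symm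
      _ ≤ ∑ y, (m ᵥ* P ^ t) y * P y z :=
          Finset.sum_le_sum fun y _ => mul_le_mul_of_nonneg_right (ih y) (hP.1 y z)
      _ = (m ᵥ* P ^ (t + 1)) z := by rw [pow_succ, ← vecMul_vecMul]; rfl

variable {π : S → ℝ} {T : ℕ} {δ ε : ℝ}

/-- The excess of `π` over `m` has the same mass as that of `m` over `π`, which is small because
`lam ^ T * m ≤ m ᵥ* P ^ T ≤ π + δ`. -/
theorem dotProduct_right_le (h : IsExtendedPerronTriple P x lam m g)
    (hP : P ∈ rowStochastic ℝ S) (hπ : IsStationaryDistribution P π)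
    (hmix : ∀ y z, |(P ^ T) y z - π z| ≤ δ) {M : ℝ} (hM : ∀ y, g y ≤ M) :
    π ⬝ᵥ g ≤ 1 + M * (1 - lam ^ T + Fintype.card S * δ) := by
  -- the quantity `(1 - lam ^ T) * m + δ + (π - m)` is nonnegative with a small sum, and it
  -- dominates `π - m`
  have hle (z : S) : 0 ≤ (1 - lam ^ T) * m z + δ + (π z - m z) := by
    have h1 : (m ᵥ* P ^ T) z ≤ π z + δ := by
      calc (m ᵥ* P ^ T) z ≤ ∑ y, m y * (π z + δ) :=
            Finset.sum_le_sum fun y _ => mul_le_mul_of_nonneg_left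
              (by linarith [(abs_le.1 (hmix y z)).2]) (h.left_nonneg y)
        _ = π z + δ := by rw [← Finset.sum_mul, h.left_sum, one_mul]
    linarith [h.pow_mul_left_le hP T z]
  have hlam : 0 ≤ 1 - lam ^ T :=
    sub_nonneg.2 (pow_le_one₀ h.eigenvalue_nonneg h.eigenvalue_le_one)
  have hdiff : π ⬝ᵥ g - m ⬝ᵥ g ≤ ∑ z, ((1 - lam ^ T) * m z + δ + (π z - m z)) * M := by
    rw [← sub_dotProduct]
    refine Finset.sum_le_sum fun z _ => ?_
    have hδ : 0 ≤ δ := (abs_nonneg _).trans (hmix z z)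
    have h1 : 0 ≤ (1 - lam ^ T) * m z + δ := add_nonneg (mul_nonneg hlam (h.left_nonneg z)) hδ
    have h2 := mul_le_mul_of_nonneg_left (hM z) (hle z)
    have h3 := mul_nonneg h1 (h.right_nonneg z)
    rw [Pi.sub_apply]
    linarith
  rw [← Finset.sum_mul, Finset.sum_add_distrib, Finset.sum_add_distrib, Finset.sum_sub_distrib,
    ← Finset.mul_sum, h.left_sum, hπ.sum_eq_one, Finset.sum_const, nsmul_eq_mul, h.normalized,
    Finset.card_univ] at hdiff
  linarith

theorem abs_pow_mulVec_sub_le {v : S → ℝ} (hmix : ∀ y z, |(P ^ T) y z - π z| ≤ δ) {M : ℝ}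
    (hv : ∀ y, 0 ≤ v y) (hM : ∀ y, v y ≤ M) (y : S) :
    |(P ^ T *ᵥ v) y - π ⬝ᵥ v| ≤ Fintype.card S * δ * M := by
  have h1 : (P ^ T *ᵥ v) y - π ⬝ᵥ v = ∑ z, ((P ^ T) y z - π z) * v z := by
    simp only [mulVec, dotProduct, sub_mul, Finset.sum_sub_distrib]
  rw [h1]
  refine (Finset.abs_sum_le_sum_abs _ _).trans ?_
  calc ∑ z, |((P ^ T) y z - π z) * v z| ≤ ∑ _z : S, δ * M := Finset.sum_le_sum fun z _ => by
        rw [abs_mul, abs_of_nonneg (hv z)]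
        exact mul_le_mul (hmix y z) (hM z) (hv z) ((abs_nonneg _).trans (hmix y z))
    _ = Fintype.card S * δ * M := by
        rw [Finset.sum_const, nsmul_eq_mul, Finset.card_univ, mul_assoc]

/-- Both bounds on the right eigenvector, with explicit errors. -/
theorem right_bounds (h : IsExtendedPerronTriple P x lam m g)
    (hP : P ∈ rowStochastic ℝ S) (hπ : IsStationaryDistribution P π) (hT : 1 ≤ T)
    (hmix : ∀ y z, |(P ^ T) y z - π z| ≤ δ) (hδπ : ∀ z, δ ≤ π z)
    (hδ : Fintype.card S * δ ≤ ε) (hTx : T * π x ≤ ε) (hε : ε ≤ 1 / 8) (y : S) :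
    (1 - 10 * ε) * g y ≤ 1 ∧ 1 - (∑ s ∈ Finset.range T, (P ^ s) y x) - 6 * ε ≤ g y := by
  have : Nonempty S := ⟨x⟩
  obtain ⟨y₀, hy₀⟩ := Finite.exists_max g
  have hM0 := h.right_nonneg y₀
  -- `g y₀` is the maximum of `g`, and `1` is the average of `g` under `m`
  have hM1 : 1 ≤ g y₀ := by
    rw [← h.normalized, ← one_mul (g y₀), ← h.left_sum, Finset.sum_mul]
    exact Finset.sum_le_sum fun z _ => mul_le_mul_of_nonneg_left (hy₀ z) (h.left_nonneg z)
  have hlam : 1 - 4 * ε ≤ lam ^ T := by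
    have := h.eigenvalue_pow_ge hP hπ hT
      (fun y z => by linarith [(abs_le.1 (hmix y z)).2, hδπ z]) (hTx.trans hε)
    linarith
  have hlam1 : lam ^ T ≤ 1 := pow_le_one₀ h.eigenvalue_nonneg h.eigenvalue_le_one
  have hπg := h.dotProduct_right_le hP hπ hmix hy₀
  have herr (z : S) : |(P ^ T *ᵥ g) z - π ⬝ᵥ g| ≤ ε * g y₀ :=
    (abs_pow_mulVec_sub_le hmix h.right_nonneg hy₀ z).trans (mul_le_mul_of_nonneg_right hδ hM0)
  have hlow : (1 - 5 * ε) * g y₀ ≤ π ⬝ᵥ g := by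
    have := h.pow_mul_right_le hP T y₀
    linarith [(abs_le.1 (herr y₀)).2, mul_le_mul_of_nonneg_right hlam hM0]
  constructor
  · by_cases h10 : 1 - 10 * ε ≤ 0
    · exact (mul_nonpos_of_nonpos_of_nonneg h10 (h.right_nonneg y)).trans zero_le_one
    · have h1 : g y₀ * (1 - lam ^ T + Fintype.card S * δ) ≤ g y₀ * (5 * ε) :=
        mul_le_mul_of_nonneg_left (by linarith) hM0
      have h2 := mul_le_mul_of_nonneg_left (hy₀ y) (not_le.1 h10).le
      linarith
  · by_contra! hlt
    have h1 := h.pow_mulVec_right_le hP hy₀ hM0 T y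
    have h2 := mul_le_of_le_one_left (h.right_nonneg y) hlam1
    have h3 := (abs_le.1 (herr y)).1
    have h4 : (1 - (∑ s ∈ Finset.range T, (P ^ s) y x) - 6 * ε) * g y₀ ≤ g y := by linarith
    have h5 := (h.right_nonneg y).trans_lt hlt
    linarith [le_mul_of_one_le_right h5.le hM1]

end IsExtendedPerronTriple

/-! ### Asymptotics -/

/-- Uniform form of the mixing hypotheses for all large `n`: the mixing error has a bound `δ` below
every `π n z` whose sum over the state space is small. The choice is `δ = n ^ (-2)`. -/
theorem eventually_mixing_error
    {X : ℕ → Type*} [∀ n, Fintype (X n)] [∀ n, DecidableEq (X n)]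
    (hcard : ∀ n, Fintype.card (X n) = n) (P : ∀ n, Matrix (X n) (X n) ℝ) (π : ∀ n, X n → ℝ)
    (hπ : ∀ᶠ n in atTop, IsStationaryDistribution (P n) (π n))
    (c : ℝ) (hc : 2 < c) (T : ℕ → ℕ)
    (hp1 : (fun n : ℕ => ⨆ p : X n × X n, |evolve (P n) (Pi.single p.1 1) (T n) p.2 - π n p.2|)
      =o[atTop] fun n : ℕ => (n : ℝ) ^ (-c))
    (hp2 : Tendsto (fun n => (T n : ℝ) * ⨆ x, π n x) atTop (𝓝 0))
    (hp3 : (fun n : ℕ => (n : ℝ) ^ (-2 : ℝ)) =o[atTop] fun n : ℕ => ⨅ x, π n x)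
    {ε : ℝ} (hε : 0 < ε) :
    ∀ᶠ n in atTop, ∃ δ : ℝ, (∀ y z, |(P n ^ T n) y z - π n z| ≤ δ) ∧ (∀ z, δ ≤ π n z) ∧
      Fintype.card (X n) * δ ≤ ε ∧ ∀ x, T n * π n x ≤ ε := by
  have hinv : Tendsto (fun n : ℕ => (n : ℝ)⁻¹) atTop (𝓝 0) := tendsto_inv_atTop_nhds_zero_nat
  filter_upwards [hπ, hp1.bound one_pos, hp3.bound one_pos, hp2.eventually_le_const hε,
    hinv.eventually_le_const hε, eventually_ge_atTop 1] with n hπ h1 h3 h2 hn hn1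
  have hn0 : (1 : ℝ) ≤ n := by exact_mod_cast hn1
  have hpow : (n : ℝ) ^ (-c) ≤ (n : ℝ) ^ (-2 : ℝ) :=
    Real.rpow_le_rpow_of_exponent_le hn0 (by linarith)
  rw [one_mul, Real.norm_eq_abs, Real.norm_eq_abs, abs_of_nonneg (a := (n : ℝ) ^ (-2 : ℝ))
    (by positivity), abs_of_nonneg (Real.iInf_nonneg hπ.nonneg)] at h3
  rw [one_mul, Real.norm_eq_abs, Real.norm_eq_abs, abs_of_nonneg (a := (n : ℝ) ^ (-c))
    (by positivity)] at h1
  refine ⟨(n : ℝ) ^ (-2 : ℝ), fun y z => ?_, fun z => ?_, ?_, fun x => ?_⟩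
  · refine le_trans ?_ (((le_abs_self _).trans h1).trans hpow)
    refine le_trans (le_of_eq ?_) (le_ciSup (f := fun p : X n × X n =>
      |evolve (P n) (Pi.single p.1 1) (T n) p.2 - π n p.2|) (Set.finite_range _).bddAbove (y, z))
    simp [evolve]
  · exact h3.trans (ciInf_le (Set.finite_range _).bddBelow z)
  · rw [hcard]
    refine le_trans (le_of_eq ?_) hn
    rw [Real.rpow_neg (by positivity), Real.rpow_two]
    field_simp
  · exact (mul_le_mul_of_nonneg_left (le_ciSup (Set.finite_range _).bddAbove x)
      (Nat.cast_nonneg _)).trans h2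

theorem theorem2
    -- state spaces of size `n`, ergodic transition matrices, stationary distributions
    {X : ℕ → Type*} [∀ n, Fintype (X n)] [∀ n, DecidableEq (X n)]
    [∀ n, MeasurableSpace (X n)] [∀ n, MeasurableSingletonClass (X n)]
    (hcard : ∀ n, Fintype.card (X n) = n)
    (P : ∀ n, rowStochastic ℝ (X n)) (π : ∀ n, X n → ℝ)
    (hergodic : ∀ᶠ n in atTop, (P n).1.IsPrimitive)
    (hπ : ∀ᶠ n in atTop, IsStationaryDistribution (P n).1 (π n))
    (hkilled : ∀ᶠ n in atTop, ∀ x, (killedKernel (P n).1 x).IsIrreducible)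
    -- Perron eigenvalue and eigenvectors of the killed kernels
    (lam : ∀ n, X n → ℝ) (μ γ : ∀ n, ∀ x : X n, {y : X n // y ≠ x} → ℝ)
    (hperron : ∀ᶠ n in atTop, ∀ x,
      IsPerronTriple (killedKernel (P n).1 x) (lam n x) (μ n x) (γ n x))
    (c : ℝ) (hc : 2 < c) (T : ℕ → ℕ) (hT : Tendsto T atTop atTop)
    -- fast mixing
    (hp1 : (fun n : ℕ => ⨆ p : X n × X n, |evolve (P n).1 (Pi.single p.1 1) (T n) p.2 - π n p.2|)
      =o[atTop] fun n : ℕ => (n : ℝ) ^ (-c))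
    -- small maximum of the stationary distribution
    (hp2 : Tendsto (fun n => (T n : ℝ) * ⨆ x, π n x) atTop (𝓝 0))
    -- large minimum of the stationary distribution
    (hp3 : (fun n : ℕ => (n : ℝ) ^ (-2 : ℝ)) =o[atTop] fun n : ℕ => ⨅ x, π n x) :
    -- upper bound
    (∀ ε : ℝ, 0 < ε → ∀ᶠ n in atTop, ∀ x, ∀ y : {y : X n // y ≠ x}, γ n x y ≤ 1 + ε) ∧
    -- lower bound, with an error that vanishes uniformly
    (∀ ε : ℝ, 0 < ε → ∀ᶠ n in atTop, ∀ x, ∀ y : {y : X n // y ≠ x},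
      max (1 - expectedLocalTime (P n) y (T n) x - ε) 0 ≤ γ n x y) ∧
    -- lower bound for the ratio, wherever its right-hand side stays away from zero
    (∀ η : ℝ, 0 < η → ∀ ε : ℝ, 0 < ε → ∀ᶠ n in atTop, ∀ x, ∀ y : {y : X n // y ≠ x},
      η ≤ max (1 - expectedLocalTime (P n) y (T n) x) 0 →
        (1 - ε) * max (1 - expectedLocalTime (P n) y (T n) x) 0 ≤ γ n x y) := by
  have key : ∀ ε : ℝ, 0 < ε → ε ≤ 1 / 8 → ∀ᶠ n in atTop, ∀ x, ∀ y : {y : X n // y ≠ x},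
      0 ≤ γ n x y ∧ (1 - 10 * ε) * γ n x y ≤ 1 ∧
        1 - expectedLocalTime (P n) y (T n) x - 6 * ε ≤ γ n x y := by
    intro ε hε hε'
    filter_upwards [hπ, hkilled, hperron, hT.eventually_ge_atTop 1,
      eventually_mixing_error hcard (fun n => (P n).1) π hπ c hc T hp1 hp2 hp3 hε]
      with n hπ hkilled hperron hT ⟨δ, hmix, hδπ, hδ, hTx⟩ x y
    have h := (hperron x).extendZero (P n).2 (hkilled x)
    have hb := h.right_bounds (P n).2 hπ hT hmix hδπ hδ (hTx x) hε' y
    rw [extendZero_coe] at hb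
    rw [expectedLocalTime_eq_sum]
    exact ⟨(hperron x).right_nonneg (hkilled x) y, hb⟩
  have lower : ∀ ε : ℝ, 0 < ε → ∀ᶠ n in atTop, ∀ x, ∀ y : {y : X n // y ≠ x},
      max (1 - expectedLocalTime (P n) y (T n) x - ε) 0 ≤ γ n x y := by
    intro ε hε
    filter_upwards [key (min (ε / 6) (1 / 8)) (by positivity) (min_le_right _ _)] with n hn x y
    obtain ⟨h0, -, h2⟩ := hn x y
    exact max_le (by linarith [min_le_left (ε / 6) (1 / 8)]) h0
  refine ⟨fun ε hε => ?_, lower, fun η hη ε hε => ?_⟩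
  · -- `1 / (1 - 10 * ε') ≤ 1 + ε` as soon as `10 * ε' * (1 + ε) ≤ ε`
    have hε' : 0 < ε / (10 * (1 + ε)) := by positivity
    filter_upwards [key (min (ε / (10 * (1 + ε))) (1 / 20)) (by positivity)
      ((min_le_right _ _).trans (by norm_num))] with n hn x y
    obtain ⟨-, h1, -⟩ := hn x y
    set ε' := min (ε / (10 * (1 + ε))) (1 / 20)
    have ha : ε' * (10 * (1 + ε)) ≤ ε := (le_div_iff₀ (by positivity)).1 (min_le_left _ _)
    have hb : ε' ≤ 1 / 20 := min_le_right _ _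
    refine le_of_mul_le_mul_left (a := 1 - 10 * ε') (h1.trans ?_) (by linarith)
    linarith
  · filter_upwards [lower (ε * η) (by positivity)] with n hn x y hηy
    have hpos : 0 < 1 - expectedLocalTime (P n) y (T n) x := by
      by_contra! h
      rw [max_eq_right h] at hηy
      linarith
    rw [max_eq_left hpos.le] at hηy ⊢
    linarith [(le_max_left _ _).trans (hn x y), mul_le_mul_of_nonneg_left hηy hε.le]
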